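/- Let $t\ge 3$ be an integer, put $\tau=\lfloor (2t+1)/3\rfloor$ and $f(b)=(t-1)b-\binom b2$, and let $n\ge 2\tau$. Write $E=E(K_n)$. Here $K_b+\bar K_{n-b}$ is the graph on $n$ vertices obtained from the disjoint union of the complete graph $K_b$ and $n-b$ isolated vertices by adding all edges between the two parts; a cyclic flat of a matroid is a flat that is a union of circuits. The *uniform $K_{1,t}$-matroid on $K_n$* is the matroid on $E$ of rank $t$ whose non-spanning circuits are exactly the edge sets of the copies of the star $K_{1,t}$ in $K_n$. The matroid *$M_{t,n}$* is the matroid on $E$ whose cyclic flats are $\emptyset$, $E$ and the edge sets of the copies of $K_b+\bar K_{n-b}$ in $K_n$ with $1\le b\le\tau-1$, with ranks $0$, $f(\tau)$ and $f(b)$ respectively. The *truncation* of a matroid $N$ of rank $k\ge1$ is the matroid of rank $k-1$ on the same ground set whose independent sets are the independent sets of $N$ of size at most $k-1$. An *erection* of a matroid $M$ is either $M$ itself (the trivial erection) or a matroid whose truncation is $M$; the *free erection* of $M$ is its greatest erection in the weak order ($N\preceq N'$ if every independent set of $N$ is independent in $N'$). The *free elevation* of $M$ is the matroid obtained from $M$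 by a sequence of non-trivial free erections, continued until there is no non-trivial erection. **Theorem.** The uniform $K_{1,t}$-matroid on $K_n$ and the matroid $M_{t,n}$ both exist and are uniquely determined by the descriptions above, and the free elevation of the uniform $K_{1,t}$-matroid on $K_n$ is $M_{t,n}$. In particular this free elevation has rank $f(\tau)=(t-1)\tau-\binom{\tau}{2}$, and its cyclic flats are the copies of $K_b+\bar K_{n-b}$ for $1\le b\le\tau-1$ together with $\emptyset$ and $E$. -/

import Mathlib

namespace Matroid

variable {α : Type*}

/-- `X` is a cyclic set of `M`: every element of `X` lies in a circuit contained in `X`. -/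
def IsCyclicSet (M : Matroid α) (X : Set α) : Prop :=
  ∀ e ∈ X, ∃ C, M.IsCircuit C ∧ e ∈ C ∧ C ⊆ X

/-- A cyclic flat of `M` is a flat of `M` that is also a cyclic set of `M`. -/
def IsCyclicFlat (M : Matroid α) (F : Set α) : Prop :=
  M.IsFlat F ∧ M.IsCyclicSet F

/-- The weak order on matroids with the same ground set: every independent set of `M` is
independent in `N`. -/
def WeakLE (M N : Matroid α) : Prop :=
  M.E = N.E ∧ ∀ I, M.Indep I → N.Indep I

/-- `M₀` is the truncation of the matroid `M₁` of finite positive rank `k`: it has the same ground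
set, its rank is `k - 1`, and its independent sets are those of `M₁` with at most `k - 1`
elements. -/
def IsTruncationOf (M₀ M₁ : Matroid α) : Prop :=
  M₀.E = M₁.E ∧ ∃ k : ℕ, M₁.eRank = ((k + 1 : ℕ) : ℕ∞) ∧ M₀.eRank = (k : ℕ∞) ∧
    ∀ I, M₀.Indep I ↔ M₁.Indep I ∧ I.encard ≤ (k : ℕ∞)

/-- `M₁` is an erection of `M₀`: either it is the trivial erection `M₀` itself, or `M₀` is the
truncation of `M₁`. -/
def IsErection (M₀ M₁ : Matroid α) : Prop :=
  M₁ = M₀ ∨ IsTruncationOf M₀ M₁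

/-- `M₁` is the free erection of `M₀`: the greatest erection of `M₀` in the weak order. -/
def IsFreeErection (M₀ M₁ : Matroid α) : Prop :=
  IsErection M₀ M₁ ∧ ∀ N, IsErection M₀ N → WeakLE N M₁

/-- `M` is the free elevation of `M₀`: it is reached from `M₀` by a finite sequence of non-trivial
free erections, and this sequence is maximum, i.e. `M` has no non-trivial erection. -/
def IsFreeElevation (M₀ M : Matroid α) : Prop :=
  Relation.ReflTransGen (fun A B => IsFreeErection A B ∧ B ≠ A) M₀ M ∧
    ∀ N, IsErection M N → N = M

end Matroid

/-- The join `G + H`: the disjoint union of `G` and `H` together with all edges between them. -/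
def graphJoin {V W : Type*} (G : SimpleGraph V) (H : SimpleGraph W) : SimpleGraph (V ⊕ W) :=
  (G ⊕g H) ⊔ completeBipartiteGraph V W

/-- The edge set of the complete graph `K_n` on `n` vertices. -/
def completeEdges (n : ℕ) : Set (Sym2 (Fin n)) :=
  (⊤ : SimpleGraph (Fin n)).edgeSet

/-- The set `F` of edges of `K_n` is (the edge set of) a copy of the graph `H`. -/
def IsCopyInComplete {W : Type*} (H : SimpleGraph W) {n : ℕ} (F : Set (Sym2 (Fin n))) : Prop :=
  ∃ φ : W ↪ Fin n, F = (H.map φ).edgeSet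

/-- `F` is a copy in `K_n` of the star `K_{1,t}`. -/
def IsStar (t : ℕ) {n : ℕ} (F : Set (Sym2 (Fin n))) : Prop :=
  IsCopyInComplete (completeBipartiteGraph (Fin 1) (Fin t)) F

/-- `F` is a copy in `K_n` of the join of `K_b` and the edgeless graph on `n - b` vertices. -/
def IsCliqueJoinIndep (b : ℕ) {n : ℕ} (F : Set (Sym2 (Fin n))) : Prop :=
  IsCopyInComplete
    (graphJoin (⊤ : SimpleGraph (Fin b)) (⊥ : SimpleGraph (Fin (n - b)))) F

/-- `M` is the uniform `K_{1,t}`-matroid on `K_n`: it has rank `t`, and its non-spanning circuits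
are exactly the copies of `K_{1,t}`. -/
def IsUniformStarMatroid (t n : ℕ) (M : Matroid (Sym2 (Fin n))) : Prop :=
  M.E = completeEdges n ∧ M.eRank = (t : ℕ∞) ∧
    ∀ C, (M.IsCircuit C ∧ ¬ M.Spanning C) ↔ IsStar t C

/-- `τ = ⌊(2t+1)/3⌋`. -/
def starTau (t : ℕ) : ℕ := (2 * t + 1) / 3

/-- `f(b) = (t-1)b - (b choose 2)`; the natural-number subtractions are exact for
`1 ≤ t` and `b ≤ t`, see `starF_cast`. -/
def starF (t b : ℕ) : ℕ := (t - 1) * b - b.choose 2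

theorem starF_cast {t b : ℕ} (ht : 1 ≤ t) (hb : b ≤ t) :
    (starF t b : ℤ) = ((t : ℤ) - 1) * b - (b.choose 2 : ℕ) := by
  have h : b.choose 2 ≤ (t - 1) * b := by
    rw [Nat.choose_two_right, mul_comm]
    exact (Nat.div_le_self _ _).trans (Nat.mul_le_mul_right b (Nat.sub_le_sub_right hb 1))
  unfold starF
  rw [Nat.cast_sub h]
  push_cast [ht]
  ring

/-- `M` is the matroid `M_{t,n}` on `K_n`: its cyclic flats are `∅`, `E(K_n)` and the copies of
`K_b + \bar K_{n-b}` for `1 ≤ b ≤ τ - 1`, of ranks `0`, `f(τ)` and `f(b)` respectively. -/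
def IsMtn (t n : ℕ) (M : Matroid (Sym2 (Fin n))) : Prop :=
  M.E = completeEdges n ∧
    (∀ F, M.IsCyclicFlat F ↔ F = ∅ ∨ F = completeEdges n ∨
      ∃ b, 1 ≤ b ∧ b ≤ starTau t - 1 ∧ IsCliqueJoinIndep b F) ∧
    M.eRk ∅ = 0 ∧
    M.eRk (completeEdges n) = (starF t (starTau t) : ℕ∞) ∧
    ∀ b, 1 ≤ b → b ≤ starTau t - 1 → ∀ F : Set (Sym2 (Fin n)), IsCliqueJoinIndep b F →
      M.eRk F = (starF t b : ℕ∞)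

/-! ### Arithmetic of f and τ. -/

open Finset

/-! For k ≤ f(τ), let M_k have as independent sets the edge sets I with |I| ≤ k such that at most
f(|B|) edges of I meet B, for every vertex set B with |B| < τ (`StarSparse`). This is a matroid
(`exists_isStarSparseMatroid`): the count of edges meeting B and the bound f deviate from modularity
by the same cross term |B∖C||C∖B|, so tight vertex sets are closed under union.

M_t is the uniform K_{1,t}-matroid and M_{f(τ)} is M_{t,n} (`isUniformStarMatroid_iff`,
`isMtn_iff`). It remains to see that M_{k+1} is the free erection of M_k for t ≤ k < f(τ), and that
M_{f(τ)} has no non-trivial erection (`IsStarSparseMatroid.isFreeErection`,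
`IsStarSparseMatroid.not_isTruncationOf`).

Both follow from submodularity in a non-trivial erection N of M_k. If f(|B|) = k, the sets of edges
meeting B−x and B−y have known rank bounds, and their intersection contains xy besides the edges
meeting B−x−y; this forces rank at most f(|B|) on the edges meeting B, so independent sets of N are
sparse. If k = f(τ), the same bound holds for |B| = τ. The edges between two disjoint τ-sets already
have rank f(τ), so both sets span the same flat; this spreads to all of E and contradicts rank
f(τ)+1. -/

theorem two_mul_starF {t b : ℕ} (hb : b + 1 ≤ 2 * t) :
    2 * starF t b + b * b + b = 2 * t * b := by
  obtain _ | c := b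
  · simp [starF]
  obtain _ | s := t
  · omega
  have h : (c + 1).choose 2 * 2 = (c + 1) * c := by
    rw [Nat.choose_two_right]
    exact Nat.div_mul_cancel (Nat.even_mul_pred_self (c + 1)).two_dvd
  have h1 : (c + 1).choose 2 ≤ s * (c + 1) := by nlinarith
  have h2 : starF (s + 1) (c + 1) + (c + 1).choose 2 = s * (c + 1) := by
    simp only [starF, Nat.add_sub_cancel]
    exact Nat.sub_add_cancel h1
  nlinarith

theorem starF_zero (t : ℕ) : starF t 0 = 0 := by simp [starF]

theorem starF_one (t : ℕ) : starF t 1 = t - 1 := by simp [starF]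

/-- The bound 3τ ≤ 2t+1 keeps tight sets closed under union; 2t ≤ 3τ+1 makes the edges between two
τ-sets numerous enough to have rank f(τ). -/
theorem starTau_bounds {t : ℕ} (ht : 3 ≤ t) :
    2 ≤ starTau t ∧ starTau t + 1 ≤ t ∧ 3 * starTau t ≤ 2 * t + 1 ∧ 2 * t ≤ 3 * starTau t + 1 := by
  unfold starTau
  omega

theorem starF_lt_starF {t a b : ℕ} (hab : a < b) (hb : b + 1 ≤ t) : starF t a < starF t b := by
  have h1 := two_mul_starF (t := t) (b := a) (by omega)
  have h2 := two_mul_starF (t := t) (b := b) (by omega)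
  nlinarith

theorem starF_le_starF {t a b : ℕ} (hab : a ≤ b) (hb : b + 1 ≤ t) : starF t a ≤ starF t b := by
  obtain rfl | h := hab.eq_or_lt
  · rfl
  · exact (starF_lt_starF h hb).le

/-- f is a concave quadratic symmetric about t − 1/2, and 3τ ≤ 2t+1 places 2τ−2 in [τ, 2t−1−τ]. The
union of two sets smaller than τ has at most 2τ−2 elements. -/
theorem starF_starTau_le {t m : ℕ} (ht : 3 ≤ t) (h1 : starTau t ≤ m)
    (h2 : m + 2 ≤ 2 * starTau t) : starF t (starTau t) ≤ starF t m := by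
  have hτ := starTau_bounds ht
  have e1 := two_mul_starF (t := t) (b := starTau t) (by omega)
  have e2 := two_mul_starF (t := t) (b := m) (by omega)
  obtain ⟨d, rfl⟩ := Nat.exists_eq_add_of_le h1
  have : 2 * starTau t + d + 1 ≤ 2 * t := by omega
  nlinarith

theorem le_starF_two {t : ℕ} (ht : 3 ≤ t) : t ≤ starF t 2 := by
  have := two_mul_starF (t := t) (b := 2) (by omega)
  omega

theorem le_starF_starTau {t : ℕ} (ht : 3 ≤ t) : t ≤ starF t (starTau t) := by
  have hτ := starTau_bounds ht
  exact (le_starF_two ht).trans (starF_le_starF hτ.1 hτ.2.1)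

theorem starF_add_starF {t p q r : ℕ} (h : p + q + r + 1 ≤ 2 * t) :
    starF t (p + q) + starF t (p + r) = starF t (p + q + r) + starF t p + q * r := by
  have e1 := two_mul_starF (t := t) (b := p + q) (by omega)
  have e2 := two_mul_starF (t := t) (b := p + r) (by omega)
  have e3 := two_mul_starF (t := t) (b := p + q + r) (by omega)
  have e4 := two_mul_starF (t := t) (b := p) (by omega)
  nlinarith

/-! ### Edges meeting a vertex set, and sparsity. -/

section Edges

variable {V : Type*} [Fintype V] [DecidableEq V]

/-- The edges of the complete graph on `V` that are incident with a vertex in `B`. -/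
def incEdges (B : Finset V) : Finset (Sym2 V) := {e | ¬ e.IsDiag ∧ ∃ v ∈ B, v ∈ e}

/-- The edges joining a vertex in `B` to a vertex in `C`. -/
def crossEdges (B C : Finset V) : Finset (Sym2 V) := (B ×ˢ C).image fun p => s(p.1, p.2)

theorem mem_incEdges {B : Finset V} {e : Sym2 V} :
    e ∈ incEdges B ↔ ¬ e.IsDiag ∧ ∃ v ∈ B, v ∈ e := by simp [incEdges]

theorem mk_mem_incEdges {B : Finset V} {u v : V} :
    s(u, v) ∈ incEdges B ↔ u ≠ v ∧ (u ∈ B ∨ v ∈ B) := by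
  simp only [mem_incEdges, Sym2.mk_isDiag_iff, Sym2.mem_iff]
  aesop

theorem incEdges_mono {B C : Finset V} (h : B ⊆ C) : incEdges B ⊆ incEdges C := by
  intro e
  simp only [mem_incEdges]
  rintro ⟨h1, v, hv, hve⟩
  exact ⟨h1, v, h hv, hve⟩

theorem incEdges_empty : incEdges (∅ : Finset V) = ∅ := by simp [incEdges]

theorem incEdges_union (B C : Finset V) : incEdges (B ∪ C) = incEdges B ∪ incEdges C := by
  ext e
  simp only [mem_incEdges, mem_union]
  aesop

omit [Fintype V] in
theorem mk_mem_crossEdges {B C : Finset V} {u v : V} :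
    s(u, v) ∈ crossEdges B C ↔ (u ∈ B ∧ v ∈ C) ∨ (v ∈ B ∧ u ∈ C) := by
  simp only [crossEdges, mem_image, mem_product, Prod.exists, Sym2.eq_iff]
  aesop

theorem incEdges_inter (B C : Finset V) :
    incEdges B ∩ incEdges C = incEdges (B ∩ C) ∪ crossEdges (B \ C) (C \ B) := by
  ext e
  induction e with | _ u v =>
  simp only [mk_mem_incEdges, mk_mem_crossEdges, mem_inter, mem_union, mem_sdiff]
  by_cases u = v
  · subst u
    tauto
  · tauto

omit [Fintype V] in
theorem card_crossEdges_le (B C : Finset V) : #(crossEdges B C) ≤ #B * #C :=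
  card_image_le.trans (card_product B C).le

omit [Fintype V] in
theorem card_crossEdges {B C : Finset V} (h : Disjoint B C) : #(crossEdges B C) = #B * #C := by
  rw [crossEdges, card_image_of_injOn, card_product]
  rintro ⟨a, b⟩ h1 ⟨c, d⟩ h2 he
  simp only [coe_product, Set.mem_prod, mem_coe] at h1 h2
  rw [Sym2.eq_iff] at he
  obtain ⟨rfl, rfl⟩ | ⟨rfl, rfl⟩ := he
  · rfl
  · exact absurd h2.2 (disjoint_left.1 h h1.1)

theorem crossEdges_subset_incEdges {B C : Finset V} (h : Disjoint B C) :
    crossEdges B C ⊆ incEdges B := by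
  intro e
  induction e with | _ u v =>
  rw [mk_mem_crossEdges, mk_mem_incEdges]
  rintro (⟨h1, h2⟩ | ⟨h1, h2⟩)
  · exact ⟨fun h3 => disjoint_left.1 h h1 (h3 ▸ h2), .inl h1⟩
  · exact ⟨fun h3 => disjoint_left.1 h h1 (h3 ▸ h2), .inr h1⟩

theorem crossEdges_sdiff_incEdges {B C D : Finset V} :
    crossEdges (B \ D) (C \ D) ⊆ crossEdges B C \ incEdges D := by
  intro e
  induction e with | _ u v =>
  simp only [mk_mem_crossEdges, mem_sdiff, mk_mem_incEdges]
  tauto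

/-- The sparsity condition defining the independent sets: `I` has at most `k` elements, and at most
`starF t #B` of them are incident with `B`, whenever `#B < starTau t`. -/
def StarSparse (t k : ℕ) (I : Finset (Sym2 V)) : Prop :=
  (∀ e ∈ I, ¬ e.IsDiag) ∧ #I ≤ k ∧ ∀ B : Finset V, #B < starTau t → #(I ∩ incEdges B) ≤ starF t #B

theorem StarSparse.subset {t k : ℕ} {I J : Finset (Sym2 V)} (hJ : StarSparse t k J) (h : I ⊆ J) :
    StarSparse t k I :=
  ⟨fun e he => hJ.1 e (h he), (card_le_card h).trans hJ.2.1, fun B hB =>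
    (card_le_card (inter_subset_inter_right h)).trans (hJ.2.2 B hB)⟩

/-- An edge meeting both B and C but not B ∩ C joins B∖C to C∖B. -/
theorem card_inter_incEdges_add_le (I : Finset (Sym2 V)) (B C : Finset V) :
    #(I ∩ incEdges B) + #(I ∩ incEdges C) ≤
      #(I ∩ incEdges (B ∪ C)) + #(I ∩ incEdges (B ∩ C)) + #(B \ C) * #(C \ B) := by
  rw [← card_union_add_card_inter, ← inter_union_distrib_left, ← incEdges_union,
    ← inter_inter_distrib_left, incEdges_inter, inter_union_distrib_left, add_assoc]
  gcongr
  exact (card_union_le _ _).trans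
    (Nat.add_le_add_left ((card_le_card inter_subset_right).trans (card_crossEdges_le _ _)) _)

omit [Fintype V] in
theorem starF_card_add {t : ℕ} {B C : Finset V} (h : #(B ∪ C) + 1 ≤ 2 * t) :
    starF t #B + starF t #C = starF t #(B ∪ C) + starF t #(B ∩ C) + #(B \ C) * #(C \ B) := by
  have h1 := card_inter_add_card_sdiff B C
  have h2 := card_inter_add_card_sdiff C B
  have h3 := card_union_add_card_inter B C
  rw [inter_comm] at h2
  have h4 : #(B ∪ C) = #(B ∩ C) + #(B \ C) + #(C \ B) := by omega
  rw [h4] at h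
  have h5 := starF_add_starF h
  rwa [← h4, h1, h2] at h5

/-- Each blocked e lies at a tight set C. Tight sets are closed under union, so a largest tight B
contains every such C. -/
theorem StarSparse.exists_tight {t k : ℕ} {I : Finset (Sym2 V)} (ht : 3 ≤ t)
    (hk : k ≤ starF t (starTau t)) (hI : StarSparse t k I) (hIk : #I < k) :
    ∃ B : Finset V, #B < starTau t ∧ #(I ∩ incEdges B) = starF t #B ∧
      ∀ e ∉ I, ¬ e.IsDiag → ¬ StarSparse t k (insert e I) → e ∈ incEdges B := by
  have hτ := starTau_bounds ht
  let T : Finset (Finset V) := {B | #B < starTau t ∧ #(I ∩ incEdges B) = starF t #B}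
  have hT : ∀ B, B ∈ T ↔ #B < starTau t ∧ #(I ∩ incEdges B) = starF t #B := by simp [T]
  obtain ⟨B, hB, hmax⟩ := exists_max_image T card
    ⟨∅, (hT ∅).2 ⟨by simp; omega, by simp [incEdges_empty, starF_zero]⟩⟩
  rw [hT] at hB
  refine ⟨B, hB.1, hB.2, fun e he hd hn => ?_⟩
  have : ∃ C : Finset V, #C < starTau t ∧ starF t #C < #(insert e I ∩ incEdges C) := by
    by_contra! h
    refine hn ⟨fun x hx => ?_, ?_, h⟩
    · obtain rfl | hx := mem_insert.1 hx
      exacts [hd, hI.1 x hx]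
    · rw [card_insert_of_notMem he]
      omega
  obtain ⟨C, hC, hCe⟩ := this
  have heC : e ∈ incEdges C := by
    by_contra h
    rw [insert_inter_of_notMem h] at hCe
    exact hCe.not_ge (hI.2.2 C hC)
  have hC2 : #(I ∩ incEdges C) = starF t #C := by
    have h1 := hI.2.2 C hC
    rw [insert_inter_of_mem heC] at hCe
    have := card_insert_le e (I ∩ incEdges C)
    omega
  have hcard := card_union_add_card_inter B C
  have hle := card_inter_incEdges_add_le I B C
  have hinter : #(B ∩ C) ≤ #B := card_le_card inter_subset_left
  have hB1 : 0 < #C := by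
    rw [card_pos, nonempty_iff_ne_empty]
    rintro rfl
    simp [incEdges_empty] at heC
  have heq := starF_card_add (t := t) (B := B) (C := C) (by omega)
  have hi := hI.2.2 (B ∩ C) (by omega)
  have hu : starF t #(B ∪ C) ≤ #(I ∩ incEdges (B ∪ C)) := by omega
  have hlt : #(B ∪ C) < starTau t := by
    -- A union of size at least τ would meet at least f(τ) ≥ k edges of I, but |I| < k.
    by_contra! h
    have h1 := starF_starTau_le ht h (by omega)
    have h2 : #(I ∩ incEdges (B ∪ C)) ≤ #I := card_le_card inter_subset_left
    omega
  have h1 := hmax (B ∪ C) ((hT _).2 ⟨hlt, (hI.2.2 _ hlt).antisymm hu⟩)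
  have h2 := eq_of_subset_of_card_le (subset_union_left : B ⊆ B ∪ C) h1
  exact incEdges_mono (h2 ▸ subset_union_right) heC

/-- If every e fails, then J ⊆ I away from the tight set B, while at B the set I already attains the
maximum f(|B|); hence |J| ≤ |I|. -/
theorem StarSparse.augment {t k : ℕ} {I J : Finset (Sym2 V)} (ht : 3 ≤ t)
    (hk : k ≤ starF t (starTau t)) (hI : StarSparse t k I) (hJ : StarSparse t k J)
    (hIJ : #I < #J) : ∃ e ∈ J, e ∉ I ∧ StarSparse t k (insert e I) := by
  by_contra! h
  obtain ⟨B, hB, hBI, hBe⟩ := hI.exists_tight ht hk (hIJ.trans_le hJ.2.1)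
  have h1 := hJ.2.2 B hB
  have h2 : J \ incEdges B ⊆ I \ incEdges B := by
    intro e he
    rw [mem_sdiff] at he ⊢
    refine ⟨?_, he.2⟩
    by_contra heI
    exact he.2 (hBe e heI (hJ.1 e he.1) (h e he.1 heI))
  have h3 := card_inter_add_card_sdiff I (incEdges B)
  have h4 := card_inter_add_card_sdiff J (incEdges B)
  have h5 := card_le_card h2
  omega

/-- `M` is the matroid on the edges of the complete graph on `V` whose independent sets are
described by `StarSparse`. -/
structure IsStarSparseMatroid (t k : ℕ) (M : Matroid (Sym2 V)) : Prop where
  ground : M.E = {e | ¬ e.IsDiag}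
  indep_iff : ∀ I : Finset (Sym2 V), M.Indep I ↔ StarSparse t k I

theorem exists_isStarSparseMatroid {t k : ℕ} (ht : 3 ≤ t) (hk : k ≤ starF t (starTau t)) :
    ∃ M : Matroid (Sym2 V), IsStarSparseMatroid t k M := by
  have h0 : StarSparse t k (∅ : Finset (Sym2 V)) := ⟨by simp, by simp, by simp⟩
  have h1 : ∀ ⦃I J : Finset (Sym2 V)⦄, StarSparse t k J → I ⊆ J → StarSparse t k I :=
    fun _ _ hJ h => hJ.subset h
  have h2 : ∀ ⦃I J : Finset (Sym2 V)⦄, StarSparse t k I → StarSparse t k J → #I < #J →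
      ∃ e ∈ J, e ∉ I ∧ StarSparse t k (insert e I) := fun _ _ hI hJ h => hI.augment ht hk hJ h
  have h3 : ∀ ⦃I : Finset (Sym2 V)⦄, StarSparse t k I →
      (I : Set (Sym2 V)) ⊆ {e : Sym2 V | ¬ e.IsDiag} := fun _ hI => hI.1
  exact ⟨(IndepMatroid.ofFinset _ _ h0 h1 h2 h3).matroid, rfl,
    fun I => IndepMatroid.ofFinset_indep _ _ h0 h1 h2 h3⟩

theorem IsStarSparseMatroid.unique {t k : ℕ} {M N : Matroid (Sym2 V)}
    (hM : IsStarSparseMatroid t k M) (hN : IsStarSparseMatroid t k N) : M = N := by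
  refine Matroid.ext_indep (hM.ground.trans hN.ground.symm) fun I _ => ?_
  lift I to Finset (Sym2 V) using I.toFinite
  rw [hM.indep_iff, hN.indep_iff]

end Edges

/-! ### Sparse sets of prescribed size. -/

section Edges

variable {V : Type*} [Fintype V] [DecidableEq V]

/-- For a largest sparse I ⊆ K, the tight D covers all that was left out. Bounding |I| below thus
reduces to bounding f(|D|) + |K∖inc D|. -/
theorem StarSparse.exists_basis {t k : ℕ} (ht : 3 ≤ t) (hk : k ≤ starF t (starTau t))
    {K : Finset (Sym2 V)} (hK : ∀ e ∈ K, ¬ e.IsDiag) :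
    ∃ I ⊆ K, StarSparse t k I ∧ (#I = k ∨ ∃ D : Finset V, #D < starTau t ∧
      K ⊆ I ∪ incEdges D ∧ #(I ∩ incEdges D) = starF t #D ∧
      #I = starF t #D + #(K \ incEdges D)) := by
  classical
  let T : Finset (Finset (Sym2 V)) := {I ∈ K.powerset | StarSparse t k I}
  have hT : ∀ I, I ∈ T ↔ I ⊆ K ∧ StarSparse t k I := by simp [T]
  obtain ⟨I, hI, hmax⟩ := exists_max_image T card
    ⟨∅, (hT ∅).2 ⟨by simp, by simp, by simp, by simp⟩⟩
  rw [hT] at hI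
  refine ⟨I, hI.1, hI.2, ?_⟩
  obtain h | h := hI.2.2.1.eq_or_lt
  · exact .inl h
  obtain ⟨D, hD, hDI, hDe⟩ := hI.2.exists_tight ht hk h
  have hsub : K ⊆ I ∪ incEdges D := by
    intro e he
    rw [mem_union, or_iff_not_imp_left]
    intro heI
    refine hDe e heI (hK e he) fun hs => ?_
    have := hmax _ ((hT _).2 ⟨insert_subset he hI.1, hs⟩)
    rw [card_insert_of_notMem heI] at this
    omega
  refine .inr ⟨D, hD, hsub, hDI, ?_⟩
  have h1 : I \ incEdges D = K \ incEdges D := by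
    refine (sdiff_subset_sdiff hI.1 le_rfl).antisymm fun e he => ?_
    rw [mem_sdiff] at he ⊢
    exact ⟨(mem_union.1 (hsub he.1)).resolve_right he.2, he.2⟩
  rw [← h1, ← hDI, card_inter_add_card_sdiff]

/-- For a given size, D destroys most cross edges when it lies in the smaller side B. -/
theorem card_crossEdges_sdiff_incEdges {B C D : Finset V} (hBC : Disjoint B C)
    (hDB : #D < #B) (hC : #B ≤ #C) : (#B - #D) * #C ≤ #(crossEdges B C \ incEdges D) := by
  have h0 := card_le_card (crossEdges_sdiff_incEdges (B := B) (C := C) (D := D))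
  rw [card_crossEdges (disjoint_of_subset_left sdiff_subset
    (disjoint_of_subset_right sdiff_subset hBC))] at h0
  refine le_trans ?_ h0
  have h1 := card_inter_add_card_sdiff B D
  have h2 := card_inter_add_card_sdiff C D
  have h3 : #(B ∩ D) + #(C ∩ D) ≤ #D := by
    rw [← card_union_of_disjoint (disjoint_of_subset_left inter_subset_left
      (disjoint_of_subset_right inter_subset_left hBC)), ← union_inter_distrib_right]
    exact card_le_card inter_subset_right
  obtain ⟨s, hs⟩ := Nat.exists_eq_add_of_le h3
  obtain ⟨d, hd⟩ := Nat.exists_eq_add_of_le hDB.le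
  have h4 : #(B \ D) = d + #(C ∩ D) + s := by omega
  have h5 : d ≤ #(C \ D) := by omega
  rw [show #B - #D = d by omega, ← h2, h4]
  nlinarith [Nat.zero_le (s * #(C \ D)), Nat.mul_le_mul_left #(C ∩ D) h5]

/-- With d = |B|−|D| > 0, f(|B|)−f(|D|) = d(2t−1−|B|−|D|)/2, which is at most d|C| by the assumed
size of C. -/
theorem starF_le_add_card_crossEdges {t : ℕ} (ht : 3 ≤ t) {B C D : Finset V}
    (hBC : Disjoint B C) (hB : #B ≤ starTau t) (hC : #B ≤ #C) (hC' : 2 * t ≤ 2 * #C + #B + 1)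
    (hD : #D < starTau t) : starF t #B ≤ starF t #D + #(crossEdges B C \ incEdges D) := by
  have hτ := starTau_bounds ht
  obtain h | h := le_or_gt #B #D
  · exact (starF_le_starF h (by omega)).trans (Nat.le_add_right _ _)
  · refine le_trans ?_ (Nat.add_le_add_left (card_crossEdges_sdiff_incEdges hBC h hC) _)
    obtain ⟨d, hd⟩ := Nat.exists_eq_add_of_le h.le
    have e1 := two_mul_starF (t := t) (b := #B) (by omega)
    have e2 := two_mul_starF (t := t) (b := #D) (by omega)
    rw [show #B - #D = d by omega]
    rw [hd] at e1 hC' ⊢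
    nlinarith

theorem starF_lt_add_card_crossEdges {t : ℕ} (ht : 3 ≤ t) {B C D : Finset V}
    (hBC : Disjoint B C) (hB : #B < starTau t) (hC : #B < #C) (hC' : 2 * t ≤ 2 * #C + #B)
    (hD : #D < starTau t) (hBD : D ≠ B) :
    starF t #B < starF t #D + #(crossEdges B C \ incEdges D) := by
  have hτ := starTau_bounds ht
  obtain h | h | h := lt_trichotomy #B #D
  · exact (starF_lt_starF h (by omega)).trans_le (Nat.le_add_right _ _)
  · rw [h, lt_add_iff_pos_right]
    refine lt_of_lt_of_le ?_ (card_le_card (crossEdges_sdiff_incEdges (D := D)))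
    rw [card_crossEdges (disjoint_of_subset_left sdiff_subset
      (disjoint_of_subset_right sdiff_subset hBC))]
    refine Nat.mul_pos (card_pos.2 ?_) (card_pos.2 ?_)
    · rw [sdiff_nonempty]
      exact fun h' => hBD (eq_of_subset_of_card_le h' h.ge).symm
    · rw [sdiff_nonempty]
      intro h'
      have := card_le_card h'
      omega
  · refine lt_of_lt_of_le ?_
      (Nat.add_le_add_left (card_crossEdges_sdiff_incEdges hBC h hC.le) _)
    obtain ⟨d, hd⟩ := Nat.exists_eq_add_of_le h.le
    have e1 := two_mul_starF (t := t) (b := #B) (by omega)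
    have e2 := two_mul_starF (t := t) (b := #D) (by omega)
    rw [show #B - #D = d by omega]
    have hd0 : 0 < d := by omega
    rw [hd] at e1 hC' ⊢
    nlinarith

theorem StarSparse.exists_subset_crossEdges {t k : ℕ} (ht : 3 ≤ t)
    (hk : k ≤ starF t (starTau t)) {B C : Finset V} (hBC : Disjoint B C) (hB : #B ≤ starTau t)
    (hC : #B ≤ #C) (hC' : 2 * t ≤ 2 * #C + #B + 1) (hBk : starF t #B ≤ k) :
    ∃ I ⊆ crossEdges B C, StarSparse t k I ∧ #I = starF t #B := by
  obtain ⟨I, hIK, hI, h⟩ := StarSparse.exists_basis ht hk (K := crossEdges B C)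
    fun e he => (mem_incEdges.1 (crossEdges_subset_incEdges hBC he)).1
  have hcard : starF t #B ≤ #I := by
    obtain h | ⟨D, hD, -, -, h⟩ := h
    · omega
    · have := starF_le_add_card_crossEdges ht hBC hB hC hC' hD
      omega
  obtain ⟨J, hJI, hJ⟩ := exists_subset_card_eq hcard
  exact ⟨J, hJI.trans hIK, hI.subset hJI, hJ⟩

theorem two_mul_le_card_compl {t : ℕ} (ht : 3 ≤ t) (hV : 2 * starTau t ≤ Fintype.card V)
    {B : Finset V} (hB : #B < starTau t) : #B < #Bᶜ ∧ 2 * t ≤ 2 * #Bᶜ + #B := by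
  have hτ := starTau_bounds ht
  have := card_compl_add_card B
  omega

/-- The strict inequality for D ≠ B leaves one edge to spare, so e can be avoided. This is what
makes `incEdges B` cyclic. -/
theorem StarSparse.exists_subset_incEdges_notMem {t k : ℕ} (ht : 3 ≤ t)
    (hk : k ≤ starF t (starTau t)) (hV : 2 * starTau t ≤ Fintype.card V)
    {B : Finset V} (hB : #B < starTau t) (hBk : starF t #B ≤ k) (e : Sym2 V) :
    ∃ I ⊆ incEdges B, e ∉ I ∧ StarSparse t k I ∧ #I = starF t #B := by
  obtain ⟨I, hIK, hI, h⟩ := StarSparse.exists_basis ht hk (K := (incEdges B).erase e)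
    fun e he => (mem_incEdges.1 (mem_of_mem_erase he)).1
  have hcard : starF t #B ≤ #I := by
    obtain h | ⟨D, hD, -, -, h⟩ := h
    · omega
    · by_cases hDB : D = B
      · rw [h, hDB]
        exact Nat.le_add_right _ _
      · have hc := two_mul_le_card_compl ht hV hB
        have h1 := starF_lt_add_card_crossEdges ht disjoint_compl_right hB hc.1 hc.2 hD hDB
        have h2 : (crossEdges B Bᶜ \ incEdges D).erase e ⊆ (incEdges B).erase e \ incEdges D := by
          rw [← erase_sdiff_comm]
          exact sdiff_subset_sdiff
            (erase_subset_erase _ (crossEdges_subset_incEdges disjoint_compl_right)) le_rfl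
        have h3 := card_le_card h2
        have h4 := pred_card_le_card_erase (s := crossEdges B Bᶜ \ incEdges D) (a := e)
        omega
  obtain ⟨J, hJI, hJ⟩ := exists_subset_card_eq hcard
  exact ⟨J, (hJI.trans hIK).trans (erase_subset _ _), fun h => by simpa using hIK (hJI h),
    hI.subset hJI, hJ⟩

theorem not_starSparse_insert {t k : ℕ} {I : Finset (Sym2 V)} {D : Finset V}
    (hD : #D < starTau t) (h : #(I ∩ incEdges D) = starF t #D) {e : Sym2 V}
    (he : e ∈ incEdges D) (heI : e ∉ I) : ¬ StarSparse t k (insert e I) := by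
  intro hs
  have := hs.2.2 D hD
  rw [insert_inter_of_mem he, card_insert_of_notMem fun h => heI (mem_inter.1 h).1] at this
  omega

/-- A tight D blocking e differs from B. Every edge from B to its complement missing D must be in I,
since otherwise B blocks it and so D meets it; this makes |I| exceed f(|B|). Hence `incEdges B` is a
flat. -/
theorem StarSparse.insert_of_notMem_incEdges {t k : ℕ} (ht : 3 ≤ t)
    (hk : k ≤ starF t (starTau t)) (hV : 2 * starTau t ≤ Fintype.card V)
    {B : Finset V} (hB : #B < starTau t) (hBk : starF t #B < k) {I : Finset (Sym2 V)}
    (hI : StarSparse t k I) (hIB : I ⊆ incEdges B) (hcard : #I = starF t #B) {e : Sym2 V}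
    (hd : ¬ e.IsDiag) (he : e ∉ incEdges B) : StarSparse t k (insert e I) := by
  by_contra hs
  obtain ⟨D, hD, hDI, hDe⟩ := hI.exists_tight ht hk (hcard.trans_lt hBk)
  have heD := hDe e (fun h => he (hIB h)) hd hs
  have hDB : D ≠ B := by
    rintro rfl
    exact he heD
  have hc := two_mul_le_card_compl ht hV hB
  have h1 := starF_lt_add_card_crossEdges ht disjoint_compl_right hB hc.1 hc.2 hD hDB
  have h2 : crossEdges B Bᶜ \ incEdges D ⊆ I \ incEdges D := by
    intro x hx
    rw [mem_sdiff] at hx ⊢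
    refine ⟨?_, hx.2⟩
    by_contra hxI
    have hxB := crossEdges_subset_incEdges disjoint_compl_right hx.1
    exact hx.2 (hDe x hxI (mem_incEdges.1 hxB).1 (not_starSparse_insert hB
      (by rw [inter_eq_left.2 hIB, hcard]) hxB hxI))
  have h3 := card_le_card h2
  have h4 := card_inter_add_card_sdiff I (incEdges D)
  omega

theorem exists_disjoint_card_eq {a b : ℕ} {B : Finset V} (hB : #B ≤ a)
    (hab : a + b ≤ Fintype.card V) :
    ∃ A C : Finset V, B ⊆ A ∧ #A = a ∧ #C = b ∧ Disjoint A C := by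
  obtain ⟨A, hBA, -, hA⟩ := exists_subsuperset_card_eq (subset_univ B) hB
    (by rw [card_univ]; omega)
  obtain ⟨C, hC, hCb⟩ := exists_subset_card_eq (s := Aᶜ) (n := b) (by rw [card_compl]; omega)
  exact ⟨A, C, hBA, hA, hCb, disjoint_left.2 fun x hx hx' => mem_compl.1 (hC hx') hx⟩

theorem StarSparse.exists_card_eq_notMem {t k : ℕ} (ht : 3 ≤ t)
    (hk : k ≤ starF t (starTau t)) (hV : 2 * starTau t ≤ Fintype.card V) (e : Sym2 V) :
    ∃ I : Finset (Sym2 V), e ∉ I ∧ StarSparse t k I ∧ #I = k := by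
  have hτ := starTau_bounds ht
  induction e with | _ u v =>
  -- Both ends of e are put in B, so e is not an edge between B and C.
  obtain ⟨B, C, huB, hB, hC, hBC⟩ := exists_disjoint_card_eq (B := {u, v})
    (card_le_two.trans hτ.1) (by omega : starTau t + starTau t ≤ Fintype.card V)
  obtain ⟨I, hIK, hI, hcard⟩ := StarSparse.exists_subset_crossEdges ht le_rfl hBC hB.le (by omega)
    (by omega) (by rw [hB])
  obtain ⟨J, hJI, hJ⟩ := exists_subset_card_eq (s := I) (n := k) (by rw [hcard, hB]; exact hk)
  refine ⟨J, fun h => ?_, ⟨(hI.subset hJI).1, hJ.le, (hI.subset hJI).2.2⟩, hJ⟩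
  have := mk_mem_crossEdges.1 (hIK (hJI h))
  have hu : u ∈ B := huB (by simp)
  have hv : v ∈ B := huB (by simp)
  rw [disjoint_left] at hBC
  obtain ⟨-, h⟩ | ⟨-, h⟩ := this
  exacts [hBC hv h, hBC hu h]

theorem Matroid.isCyclicSet_of_forall {α : Type*} {M : Matroid α} {X : Set α}
    (h : ∀ e ∈ X, ∃ I ⊆ X, e ∉ I ∧ e ∈ M.closure I) : M.IsCyclicSet X := by
  intro e he
  obtain ⟨I, hIX, heI, hecl⟩ := h e he
  obtain ⟨C, hC, hCc, heC⟩ := exists_isCircuit_of_mem_closure hecl heI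
  exact ⟨C, hCc, heC, hC.trans (Set.insert_subset he hIX)⟩

/-! ### Rank, flats and cyclic flats of M_k. -/

namespace IsStarSparseMatroid

variable {t k : ℕ} {M : Matroid (Sym2 V)}

theorem incEdges_subset_ground (h : IsStarSparseMatroid t k M) (B : Finset V) :
    (incEdges B : Set (Sym2 V)) ⊆ M.E := by
  rw [h.ground]
  exact fun e he => (mem_incEdges.1 (mem_coe.1 he)).1

theorem mem_closure (h : IsStarSparseMatroid t k M) {I : Finset (Sym2 V)}
    (hI : StarSparse t k I) {e : Sym2 V} (hd : ¬ e.IsDiag) (he : ¬ StarSparse t k (insert e I)) :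
    e ∈ M.closure I := by
  have hE : e ∈ M.E := by
    rw [h.ground]
    exact hd
  by_contra hcl
  have := (((h.indep_iff I).2 hI).notMem_closure_iff hE).1 hcl
  rw [← coe_insert, h.indep_iff] at this
  exact he this.1

theorem eRank_eq (h : IsStarSparseMatroid t k M) (ht : 3 ≤ t) (hk : k ≤ starF t (starTau t))
    (hV : 2 * starTau t ≤ Fintype.card V) : M.eRank = k := by
  rw [Matroid.eRank_def]
  refine le_antisymm (Matroid.eRk_le_iff.2 fun I _ hI => ?_) ?_
  · lift I to Finset (Sym2 V) using I.toFinite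
    rw [Set.encard_coe_eq_coe_finsetCard]
    exact_mod_cast ((h.indep_iff I).1 hI).2.1
  · have : Nonempty V := Fintype.card_pos_iff.1 (by have := starTau_bounds ht; omega)
    obtain ⟨v⟩ := this
    obtain ⟨I, -, hI, hcard⟩ := StarSparse.exists_card_eq_notMem ht hk hV s(v, v)
    have hI' := (h.indep_iff I).2 hI
    refine le_trans ?_ (hI'.encard_le_eRk_of_subset hI'.subset_ground)
    rw [Set.encard_coe_eq_coe_finsetCard, hcard]

theorem eRk_incEdges_le (h : IsStarSparseMatroid t k M) {B : Finset V} (hB : #B < starTau t) :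
    M.eRk (incEdges B) ≤ starF t #B := by
  refine Matroid.eRk_le_iff.2 fun I hIB hI => ?_
  lift I to Finset (Sym2 V) using I.toFinite
  rw [Set.encard_coe_eq_coe_finsetCard]
  have := ((h.indep_iff I).1 hI).2.2 B hB
  rw [inter_eq_left.2 (coe_subset.1 hIB)] at this
  exact_mod_cast this

theorem isBasis_incEdges (h : IsStarSparseMatroid t k M) {B : Finset V} (hB : #B < starTau t)
    {I : Finset (Sym2 V)} (hI : StarSparse t k I) (hIB : I ⊆ incEdges B)
    (hcard : #I = starF t #B) : M.IsBasis I (incEdges B : Set (Sym2 V)) := by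
  have hI' := (h.indep_iff I).2 hI
  refine hI'.isBasis_of_eRk_ge I.finite_toSet (coe_subset.2 hIB) ?_ (h.incEdges_subset_ground B)
  rw [hI'.eRk_eq_encard, Set.encard_coe_eq_coe_finsetCard, hcard]
  exact h.eRk_incEdges_le hB

theorem eRk_incEdges (h : IsStarSparseMatroid t k M) (ht : 3 ≤ t)
    (hk : k ≤ starF t (starTau t)) (hV : 2 * starTau t ≤ Fintype.card V)
    {B : Finset V} (hB : #B < starTau t) (hBk : starF t #B ≤ k) :
    M.eRk (incEdges B) = starF t #B := by
  have : Nonempty V := Fintype.card_pos_iff.1 (by have := starTau_bounds ht; omega)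
  obtain ⟨v⟩ := this
  obtain ⟨I, hIB, -, hI, hcard⟩ :=
    StarSparse.exists_subset_incEdges_notMem ht hk hV hB hBk s(v, v)
  rw [(h.isBasis_incEdges hB hI hIB hcard).eRk_eq_encard, Set.encard_coe_eq_coe_finsetCard, hcard]

theorem isFlat_incEdges (h : IsStarSparseMatroid t k M) (ht : 3 ≤ t)
    (hk : k ≤ starF t (starTau t)) (hV : 2 * starTau t ≤ Fintype.card V)
    {B : Finset V} (hB : #B < starTau t) (hBk : starF t #B < k) :
    M.IsFlat (incEdges B : Set (Sym2 V)) := by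
  have : Nonempty V := Fintype.card_pos_iff.1 (by have := starTau_bounds ht; omega)
  obtain ⟨v⟩ := this
  obtain ⟨I, hIB, -, hI, hcard⟩ :=
    StarSparse.exists_subset_incEdges_notMem ht hk hV hB hBk.le s(v, v)
  rw [Matroid.isFlat_iff_closure_eq]
  refine subset_antisymm (fun e he => ?_) (M.subset_closure _ (h.incEdges_subset_ground B))
  by_contra heB
  rw [← (h.isBasis_incEdges hB hI hIB hcard).closure_eq_closure] at he
  have heE : ¬ e.IsDiag := by
    have := M.closure_subset_ground _ he
    rwa [h.ground] at this
  have hs := hI.insert_of_notMem_incEdges ht hk hV hB hBk hIB hcard heE heB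
  have heI : e ∉ (I : Set (Sym2 V)) := fun h' => heB (hIB h')
  rw [((h.indep_iff I).2 hI).mem_closure_iff_of_notMem heI, ← coe_insert] at he
  exact he.not_indep ((h.indep_iff _).2 hs)

theorem isCyclicSet_incEdges (h : IsStarSparseMatroid t k M) (ht : 3 ≤ t)
    (hk : k ≤ starF t (starTau t)) (hV : 2 * starTau t ≤ Fintype.card V)
    {B : Finset V} (hB : #B < starTau t) (hBk : starF t #B ≤ k) :
    M.IsCyclicSet (incEdges B : Set (Sym2 V)) := by
  refine Matroid.isCyclicSet_of_forall fun e he => ?_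
  obtain ⟨I, hIB, heI, hI, hcard⟩ :=
    StarSparse.exists_subset_incEdges_notMem ht hk hV hB hBk e
  exact ⟨I, hIB, heI, (h.isBasis_incEdges hB hI hIB hcard).subset_closure he⟩

theorem closure_eq_ground (h : IsStarSparseMatroid t k M) {I : Finset (Sym2 V)}
    (hI : StarSparse t k I) (hcard : #I = k) : M.closure I = M.E := by
  refine (M.closure_subset_ground _).antisymm fun e he => ?_
  by_cases heI : e ∈ I
  · exact M.mem_closure_of_mem (mem_coe.2 heI) ((h.indep_iff I).2 hI).subset_ground
  · rw [h.ground] at he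
    refine h.mem_closure hI he fun hs => ?_
    have := hs.2.1
    rw [card_insert_of_notMem heI] at this
    omega

theorem isCyclicFlat_iff (h : IsStarSparseMatroid t (starF t (starTau t)) M) (ht : 3 ≤ t)
    (hV : 2 * starTau t ≤ Fintype.card V) {F : Set (Sym2 V)} :
    M.IsCyclicFlat F ↔ F = M.E ∨ ∃ B : Finset V, #B < starTau t ∧ F = incEdges B := by
  have hτ := starTau_bounds ht
  constructor
  · rintro ⟨hF, hcyc⟩
    lift F to Finset (Sym2 V) using F.toFinite
    obtain ⟨I, hIF, hI, h1⟩ := StarSparse.exists_basis ht le_rfl (K := F) fun e he => by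
      have := hF.subset_ground (mem_coe.2 he)
      rwa [h.ground] at this
    have hcl : M.closure I ⊆ F := by
      have := M.closure_subset_closure (coe_subset.2 hIF)
      rwa [hF.closure] at this
    obtain h1 | ⟨D, hD, hsub, hDI, -⟩ := h1
    · left
      rw [h.closure_eq_ground hI h1] at hcl
      exact hF.subset_ground.antisymm hcl
    · right
      refine ⟨D, hD, subset_antisymm (fun e he => ?_) fun e he => ?_⟩
      · by_contra heD
        have heI : e ∈ I := (mem_union.1 (hsub he)).resolve_right heD
        obtain ⟨C, hC, heC, hCF⟩ := hcyc e he
        -- Removing e, which misses D, keeps D tight. So I−e still spans every edge meeting D, and a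
        -- circuit through e would put e in the closure of I−e.
        have h2 : C \ {e} ⊆ M.closure (I.erase e) := by
          rintro x ⟨hxC, hxe⟩
          by_cases hxI : x ∈ I
          · exact M.mem_closure_of_mem (mem_coe.2 (mem_erase.2 ⟨hxe, hxI⟩))
              ((h.indep_iff _).2 (hI.subset (erase_subset e I))).subset_ground
          · have hxD := (mem_union.1 (hsub (hCF hxC))).resolve_left hxI
            refine h.mem_closure (hI.subset (erase_subset e I)) (mem_incEdges.1 hxD).1
              (not_starSparse_insert hD ?_ hxD fun h' => hxI (mem_of_mem_erase h'))
            rwa [erase_inter, erase_eq_of_notMem fun h' => heD (mem_inter.1 h').2]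
        have h3 := M.closure_subset_closure_of_subset_closure h2
          (hC.mem_closure_sdiff_singleton_of_mem heC)
        rw [coe_erase] at h3
        exact ((h.indep_iff I).2 hI).notMem_closure_sdiff_of_mem (mem_coe.2 heI) h3
      · by_cases heI : e ∈ I
        · exact hIF heI
        · exact hcl (h.mem_closure hI (mem_incEdges.1 (mem_coe.1 he)).1
            (not_starSparse_insert hD hDI (mem_coe.1 he) heI))
  · rintro (rfl | ⟨B, hB, rfl⟩)
    · refine ⟨M.ground_isFlat, Matroid.isCyclicSet_of_forall fun e he => ?_⟩
      obtain ⟨I, heI, hI, hcard⟩ := StarSparse.exists_card_eq_notMem ht le_rfl hV e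
      refine ⟨I, ((h.indep_iff I).2 hI).subset_ground, heI, ?_⟩
      rwa [h.closure_eq_ground hI hcard]
    · have hlt := starF_lt_starF hB hτ.2.1
      exact ⟨h.isFlat_incEdges ht le_rfl hV hB hlt, h.isCyclicSet_incEdges ht le_rfl hV hB hlt.le⟩

end IsStarSparseMatroid

end Edges

theorem Matroid.WeakLE.antisymm {α : Type*} {M N : Matroid α} (h : M.WeakLE N) (h' : N.WeakLE M) :
    M = N :=
  Matroid.ext_indep h.1 fun I _ => ⟨h.2 I, h'.2 I⟩

namespace IsStarSparseMatroid

variable {V : Type*} [Fintype V] [DecidableEq V] {t k : ℕ} {M M' N : Matroid (Sym2 V)}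

theorem isTruncationOf (h : IsStarSparseMatroid t k M) (h' : IsStarSparseMatroid t (k + 1) M')
    (ht : 3 ≤ t) (hk : k + 1 ≤ starF t (starTau t)) (hV : 2 * starTau t ≤ Fintype.card V) :
    M.IsTruncationOf M' := by
  refine ⟨h.ground.trans h'.ground.symm, k, h'.eRank_eq ht hk hV, h.eRank_eq ht (by omega) hV,
    fun I => ?_⟩
  lift I to Finset (Sym2 V) using I.toFinite
  rw [h.indep_iff, h'.indep_iff, Set.encard_coe_eq_coe_finsetCard, Nat.cast_le]
  exact ⟨fun hI => ⟨⟨hI.1, hI.2.1.trans (Nat.le_succ k), hI.2.2⟩, hI.2.1⟩,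
    fun hI => ⟨hI.1.1, hI.2, hI.1.2.2⟩⟩

/-! ### Rank bounds in a non-trivial erection N of M_k. -/

section Erection

variable (h : IsStarSparseMatroid t k M) (ht : 3 ≤ t) (hk : k ≤ starF t (starTau t))
  (hV : 2 * starTau t ≤ Fintype.card V) (hN : M.IsTruncationOf N)
include h ht hk hV hN

theorem eRank_erection : N.eRank = (k + 1 : ℕ) := by
  obtain ⟨-, j, h1, h2, -⟩ := hN
  rw [h.eRank_eq ht hk hV, Nat.cast_inj] at h2
  rw [h1, h2]

theorem indep_erection_iff (I : Finset (Sym2 V)) : StarSparse t k I ↔ N.Indep I ∧ #I ≤ k := by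
  obtain ⟨-, j, -, h2, h3⟩ := hN
  rw [h.eRank_eq ht hk hV, Nat.cast_inj] at h2
  rw [← h.indep_iff, h3, h2, Set.encard_coe_eq_coe_finsetCard, Nat.cast_le]

theorem card_le_eRk_erection {I : Finset (Sym2 V)} (hI : StarSparse t k I) {X : Set (Sym2 V)}
    (hIX : (I : Set (Sym2 V)) ⊆ X) : (#I : ℕ∞) ≤ N.eRk X := by
  rw [← Set.encard_coe_eq_coe_finsetCard]
  exact ((h.indep_erection_iff ht hk hV hN I).1 hI).1.encard_le_eRk_of_subset hIX

/-- A larger independent set would contain one of size f(|B|)+1 ≤ k, which is independent in M_k. -/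
theorem eRk_erection_incEdges_le_of_lt {B : Finset V} (hB : #B < starTau t)
    (hBk : starF t #B < k) : N.eRk (incEdges B) ≤ starF t #B := by
  refine Matroid.eRk_le_iff.2 fun I hIB hI => ?_
  lift I to Finset (Sym2 V) using I.toFinite
  rw [Set.encard_coe_eq_coe_finsetCard, Nat.cast_le]
  by_contra! hlt
  obtain ⟨J, hJI, hJ⟩ := exists_subset_card_eq (Nat.succ_le_of_lt hlt)
  have hJs := (h.indep_erection_iff ht hk hV hN J).2 ⟨hI.subset (coe_subset.2 hJI), by omega⟩
  have := hJs.2.2 B hB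
  rw [inter_eq_left.2 (hJI.trans (coe_subset.1 hIB))] at this
  omega

/-- Submodularity for B−x and B−y: with b = |B|−2, the intersection has rank at least f(b)+1 because
of the edge xy, and 2f(b+1) − f(b) − 1 = f(b+2). -/
theorem eRk_erection_incEdges_le {B : Finset V} (hB2 : 2 ≤ #B) (hB : #B ≤ starTau t)
    (hBk : starF t #B = k) : N.eRk (incEdges B) ≤ starF t #B := by
  have hτ := starTau_bounds ht
  obtain ⟨x, hx, y, hy, hxy⟩ := one_lt_card.1 (by omega : 1 < #B)
  have hx1 := card_erase_of_mem hx
  have hy1 := card_erase_of_mem hy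
  have hxy1 := card_erase_of_mem (mem_erase.2 ⟨hxy.symm, hy⟩)
  obtain ⟨b, hb⟩ := Nat.exists_eq_add_of_le' hB2
  have e1 : #(B.erase x) = b + 1 := by omega
  have e2 : #(B.erase y) = b + 1 := by omega
  have e3 : #((B.erase x).erase y) = b := by omega
  have l1 : starF t (b + 1) < k := hBk ▸ starF_lt_starF (by omega) (by omega)
  have l2 : starF t b < k := (starF_lt_starF (by omega) (by omega)).trans l1
  have r1 := h.eRk_erection_incEdges_le_of_lt ht hk hV hN (B := B.erase x) (by omega) (by rwa [e1])
  have r2 := h.eRk_erection_incEdges_le_of_lt ht hk hV hN (B := B.erase y) (by omega) (by rwa [e2])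
  obtain ⟨J, hJB, hJe, hJ, hJcard⟩ := StarSparse.exists_subset_incEdges_notMem ht hk hV
    (B := (B.erase x).erase y) (by omega) (by rw [e3]; exact l2.le) s(x, y)
  have hins := hJ.insert_of_notMem_incEdges ht hk hV (by omega) (by rwa [e3]) hJB hJcard
    (e := s(x, y)) (by simpa using hxy) (by simp [mk_mem_incEdges])
  have r3 := h.card_le_eRk_erection ht hk hV hN hins
    (X := (incEdges (B.erase x) : Set (Sym2 V)) ∩ incEdges (B.erase y)) (by
      rw [← coe_inter, coe_subset]
      refine insert_subset ?_ (hJB.trans (subset_inter ?_ ?_))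
      · simp [mk_mem_incEdges, hx, hy, hxy, hxy.symm]
      · exact incEdges_mono (erase_subset _ _)
      · rw [erase_right_comm]
        exact incEdges_mono (erase_subset _ _))
  rw [card_insert_of_notMem hJe, hJcard, e3] at r3
  have hU : (incEdges (B.erase x) : Set (Sym2 V)) ∪ incEdges (B.erase y) = incEdges B := by
    rw [← coe_union, ← incEdges_union]
    congr 2
    ext v
    simp only [mem_union, mem_erase]
    by_cases hvx : v = x
    · subst hvx
      simp [hxy]
    · simp [hvx]
  have r4 := N.eRk_submod (incEdges (B.erase x)) (incEdges (B.erase y))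
  rw [hU] at r4
  rw [e1] at r1
  rw [e2] at r2
  have r5 := ((add_le_add_left r3 _).trans r4).trans (add_le_add r1 r2)
  have hf := starF_add_starF (t := t) (p := b) (q := 1) (r := 1) (by omega)
  have hf' : starF t (b + 1) + starF t (b + 1) = (starF t b + 1) + starF t #B := by
    rw [hf, hb]
    ring
  rw [← Nat.cast_add, hf', Nat.cast_add] at r5
  exact (ENat.add_le_add_iff_left (ENat.natCast_ne_top _)).1 r5

theorem weakLE_of_isTruncationOf (htk : t ≤ k)
    (h' : IsStarSparseMatroid t (k + 1) M') : N.WeakLE M' := by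
  have hNE : N.E = M'.E := by rw [← hN.1, h.ground, h'.ground]
  refine ⟨hNE, fun I hI => ?_⟩
  lift I to Finset (Sym2 V) using I.toFinite
  have hcard : #I ≤ k + 1 := by
    have := hI.encard_le_eRank
    rwa [h.eRank_erection ht hk hV hN, Set.encard_coe_eq_coe_finsetCard, Nat.cast_le] at this
  rw [h'.indep_iff]
  refine ⟨fun e he => ?_, hcard, fun B hB => ?_⟩
  · have := hI.subset_ground he
    rwa [hNE, h'.ground] at this
  · have hIB : (#(I ∩ incEdges B) : ℕ∞) ≤ N.eRk (incEdges B) := by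
      rw [← Set.encard_coe_eq_coe_finsetCard]
      exact (hI.subset (coe_subset.2 inter_subset_left)).encard_le_eRk_of_subset
        (coe_subset.2 inter_subset_right)
    obtain hlt | heq | hgt := lt_trichotomy (starF t #B) k
    · exact_mod_cast hIB.trans (h.eRk_erection_incEdges_le_of_lt ht hk hV hN hB hlt)
    · refine Nat.cast_le.1 (hIB.trans (h.eRk_erection_incEdges_le ht hk hV hN ?_ hB.le heq))
      -- f(0) = 0 and f(1) = t−1 are below t ≤ k, so f(|B|) = k forces |B| ≥ 2.
      by_contra! h2
      have h0 := starF_zero t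
      have h1 := starF_one t
      have h3 : #B = 0 ∨ #B = 1 := by omega
      obtain h3 | h3 := h3 <;> rw [h3] at heq <;> omega
    · have := card_le_card (inter_subset_left : I ∩ incEdges B ⊆ I)
      omega

end Erection

theorem not_isTruncationOf (h : IsStarSparseMatroid t (starF t (starTau t)) M) (ht : 3 ≤ t)
    (hV : 2 * starTau t ≤ Fintype.card V) : ¬ M.IsTruncationOf N := by
  intro hN
  have hτ := starTau_bounds ht
  have hNE : N.E = {e | ¬ e.IsDiag} := by rw [← hN.1, h.ground]
  have hcl : ∀ B C : Finset V, #B = starTau t → #C = starTau t → Disjoint B C →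
      (incEdges C : Set (Sym2 V)) ⊆ N.closure (incEdges B) := by
    intro B C hB hC hBC
    obtain ⟨I, hIK, hI, hcard⟩ := StarSparse.exists_subset_crossEdges ht le_rfl hBC hB.le
      (by omega) (by omega) (by rw [hB])
    have hIB : I ⊆ incEdges B := hIK.trans (crossEdges_subset_incEdges hBC)
    have hIC : I ⊆ incEdges C := by
      intro e he
      have := hIK he
      induction e with | _ u v =>
      rw [mk_mem_crossEdges, or_comm, and_comm, and_comm (a := u ∈ B), ← mk_mem_crossEdges]
        at this
      exact crossEdges_subset_incEdges hBC.symm this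
    have r1 := h.card_le_eRk_erection ht le_rfl hV hN hI (coe_subset.2 hIB)
    have r2 := h.card_le_eRk_erection ht le_rfl hV hN hI
      (X := (incEdges B : Set (Sym2 V)) ∩ incEdges C)
      (Set.subset_inter (coe_subset.2 hIB) (coe_subset.2 hIC))
    have r3 := h.eRk_erection_incEdges_le ht le_rfl hV hN (B := B) (by omega) hB.le (by rw [hB])
    have r4 := h.eRk_erection_incEdges_le ht le_rfl hV hN (B := C) (by omega) hC.le (by rw [hC])
    -- The intersection already has rank f(τ), so the union has rank at most f(τ), no more than
    -- `incEdges B` alone.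
    have r5 := ((add_le_add_left r2 _).trans (N.eRk_submod _ _)).trans (add_le_add r3 r4)
    rw [hcard, hB] at r1
    rw [hcard, hB, hC, ENat.add_le_add_iff_left (ENat.natCast_ne_top _)] at r5
    have := N.isRkFinite_set (incEdges B : Set (Sym2 V))
    have heq := this.closure_eq_closure_of_subset_of_eRk_ge_eRk Set.subset_union_left (r5.trans r1)
    rw [heq]
    refine Set.subset_union_right.trans (N.subset_closure _ ?_)
    rw [hN.1.symm]
    exact Set.union_subset (h.incEdges_subset_ground B) (h.incEdges_subset_ground C)
  obtain ⟨B, -, hB⟩ := exists_subset_card_eq (s := (univ : Finset V)) (n := starTau t)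
    (by rw [card_univ]; omega)
  have hE : N.E ⊆ N.closure (incEdges B) := by
    intro e he
    by_cases heB : e ∈ incEdges B
    · exact N.mem_closure_of_mem (mem_coe.2 heB) (hN.1 ▸ h.incEdges_subset_ground B)
    · induction e with | _ u v =>
      rw [hNE, Set.mem_ofPred_eq, Sym2.mk_isDiag_iff] at he
      rw [mk_mem_incEdges] at heB
      have hu : u ∉ B := fun h => heB ⟨he, .inl h⟩
      -- n ≥ 2τ leaves room for a τ-set that avoids B and contains u.
      obtain ⟨C, huC, hCB, hC⟩ := exists_subsuperset_card_eq (s := {u}) (t := Bᶜ) (n := starTau t)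
        (by simpa using hu) (by simp; omega) (by rw [card_compl]; omega)
      refine hcl B C hB hC (disjoint_left.2 fun x hx hx' => mem_compl.1 (hCB hx') hx) ?_
      exact mem_coe.2 (mk_mem_incEdges.2 ⟨he, .inl (huC (mem_singleton_self u))⟩)
  have h1 := N.eRk_mono hE
  rw [N.eRk_ground, N.eRk_closure_eq, h.eRank_erection ht le_rfl hV hN] at h1
  have h2 := h1.trans
    (h.eRk_erection_incEdges_le ht le_rfl hV hN (B := B) (by omega) hB.le (by rw [hB]))
  rw [Nat.cast_le, hB] at h2
  omega

/-! ### The chain of free erections. -/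

theorem eq_of_isErection (h : IsStarSparseMatroid t (starF t (starTau t)) M) (ht : 3 ≤ t)
    (hV : 2 * starTau t ≤ Fintype.card V) (hN : M.IsErection N) : N = M :=
  hN.resolve_right (h.not_isTruncationOf ht hV)

theorem ne_of_succ (h : IsStarSparseMatroid t k M) (h' : IsStarSparseMatroid t (k + 1) M')
    (ht : 3 ≤ t) (hk : k + 1 ≤ starF t (starTau t)) (hV : 2 * starTau t ≤ Fintype.card V) :
    M' ≠ M := by
  rintro rfl
  have := (h.eRank_eq ht (by omega) hV).symm.trans (h'.eRank_eq ht hk hV)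
  rw [Nat.cast_inj] at this
  omega

theorem isFreeErection (h : IsStarSparseMatroid t k M) (h' : IsStarSparseMatroid t (k + 1) M')
    (ht : 3 ≤ t) (htk : t ≤ k) (hk : k + 1 ≤ starF t (starTau t))
    (hV : 2 * starTau t ≤ Fintype.card V) : M.IsFreeErection M' := by
  have hMM' := h.isTruncationOf h' ht hk hV
  refine ⟨.inr hMM', fun N hN => ?_⟩
  obtain rfl | hN := hN
  · obtain ⟨hE, j, -, -, hj⟩ := hMM'
    exact ⟨hE, fun I hI => ((hj I).1 hI).1⟩
  · exact h.weakLE_of_isTruncationOf ht (by omega) hV hN htk h'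

theorem isFreeElevation (h : IsStarSparseMatroid t t M)
    (h' : IsStarSparseMatroid t (starF t (starTau t)) M') (ht : 3 ≤ t)
    (hV : 2 * starTau t ≤ Fintype.card V) : M.IsFreeElevation M' := by
  refine ⟨?_, fun N hN => h'.eq_of_isErection ht hV hN⟩
  suffices H : ∀ k, t ≤ k → k ≤ starF t (starTau t) → ∀ A : Matroid (Sym2 V),
      IsStarSparseMatroid t k A →
      Relation.ReflTransGen (fun A B => A.IsFreeErection B ∧ B ≠ A) M A from
    H _ (le_starF_starTau ht) le_rfl M' h'
  intro k hk
  induction k, hk using Nat.le_induction with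
  | base =>
    intro _ A hA
    rw [h.unique hA]
  | succ k hk ih =>
    intro hk' A hA
    obtain ⟨B, hB⟩ := exists_isStarSparseMatroid (V := V) ht (Nat.le_of_succ_le hk')
    exact (ih (by omega) B hB).tail ⟨hB.isFreeErection hA ht hk hk' hV, hB.ne_of_succ hA ht hk' hV⟩

/-- Free erections are unique since the weak order is antisymmetric. So any chain from M_t runs
through the M_k, and it can stop only at k = f(τ). -/
theorem isStarSparseMatroid_of_isFreeElevation (h : IsStarSparseMatroid t t M) (ht : 3 ≤ t)
    (hV : 2 * starTau t ≤ Fintype.card V) (hN : M.IsFreeElevation N) :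
    IsStarSparseMatroid t (starF t (starTau t)) N := by
  obtain ⟨hchain, hmax⟩ := hN
  have H : ∃ k, t ≤ k ∧ k ≤ starF t (starTau t) ∧ IsStarSparseMatroid t k N := by
    clear hmax
    induction hchain with
    | refl => exact ⟨t, le_rfl, le_starF_starTau ht, h⟩
    | tail _ hAB ih =>
      obtain ⟨k, htk, hk, hA⟩ := ih
      obtain hk | rfl := Nat.lt_or_eq_of_le hk
      · obtain ⟨C, hC⟩ := exists_isStarSparseMatroid (V := V) ht hk
        have hAC := hA.isFreeErection hC ht htk hk hV
        obtain rfl := (hAB.1.2 _ hAC.1).antisymm (hAC.2 _ hAB.1.1)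
        exact ⟨k + 1, by omega, hk, hC⟩
      · exact absurd (hA.eq_of_isErection ht hV hAB.1.1) hAB.2
  obtain ⟨k, htk, hk, hA⟩ := H
  obtain hk | rfl := Nat.lt_or_eq_of_le hk
  · obtain ⟨C, hC⟩ := exists_isStarSparseMatroid (V := V) ht hk
    exact absurd (hmax C (.inr (hA.isTruncationOf hC ht hk hV))) (hA.ne_of_succ hC ht hk hV)
  · exact hA

end IsStarSparseMatroid

/-! ### Graph copies in terms of vertex sets. -/

theorem completeEdges_eq (n : ℕ) : completeEdges n = {e | ¬ e.IsDiag} := by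
  rw [completeEdges, SimpleGraph.edgeSet_top]
  rfl

theorem coe_eq_edgeSet_map {V W : Type*} {H : SimpleGraph W} {φ : W ↪ V} {F : Set (Sym2 V)}
    (h : ∀ u v, s(u, v) ∈ F ↔ ∃ x y, H.Adj x y ∧ φ x = u ∧ φ y = v) : F = (H.map φ).edgeSet := by
  ext e
  induction e with | _ u v =>
  rw [SimpleGraph.mem_edgeSet, SimpleGraph.map_adj, h]

theorem edgeSet_map_cliqueJoinIndep {b c n : ℕ} (φ : Fin b ⊕ Fin c ↪ Fin n) (h : b + c = n) :
    ((graphJoin (⊤ : SimpleGraph (Fin b)) (⊥ : SimpleGraph (Fin c))).map φ).edgeSet =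
      incEdges (univ.map (Function.Embedding.inl.trans φ)) := by
  have hφ : Function.Surjective φ :=
    ((Fintype.bijective_iff_injective_and_card φ).2 ⟨φ.injective, by simp [h]⟩).2
  refine (coe_eq_edgeSet_map fun u v => ?_).symm
  obtain ⟨x, rfl⟩ := hφ u
  obtain ⟨y, rfl⟩ := hφ v
  simp only [mem_coe, mk_mem_incEdges, φ.injective.eq_iff, ne_eq, exists_eq_right_right]
  rcases x with x | x <;> rcases y with y | y <;> simp [graphJoin, φ.injective.eq_iff]

theorem isCliqueJoinIndep_iff {b n : ℕ} (hb : b ≤ n) {F : Set (Sym2 (Fin n))} :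
    IsCliqueJoinIndep b F ↔ ∃ B : Finset (Fin n), #B = b ∧ F = incEdges B := by
  constructor
  · rintro ⟨φ, rfl⟩
    exact ⟨_, by simp, edgeSet_map_cliqueJoinIndep φ (by omega)⟩
  · rintro ⟨B, hB, rfl⟩
    let φ := (finSumEquivOfFinset (n := n - b) hB (by rw [card_compl, hB, Fintype.card_fin]))
    refine ⟨φ.toEmbedding, ?_⟩
    rw [edgeSet_map_cliqueJoinIndep _ (by omega)]
    congr 2
    ext x
    have hx : x ∈ B ↔ ∃ a, B.orderEmbOfFin hB a = x := by
      rw [← mem_coe, ← range_orderEmbOfFin B hB, Set.mem_range]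
    simpa [φ] using hx

theorem edgeSet_map_star {t n : ℕ} (φ : Fin 1 ⊕ Fin t ↪ Fin n) :
    ((completeBipartiteGraph (Fin 1) (Fin t)).map φ).edgeSet =
      crossEdges {φ (.inl 0)} (univ.map (Function.Embedding.inr.trans φ)) := by
  refine (coe_eq_edgeSet_map fun u v => ?_).symm
  rw [mem_coe, mk_mem_crossEdges]
  simp only [mem_singleton, mem_map, mem_univ, true_and, Function.Embedding.trans_apply,
    Function.Embedding.inr_apply, completeBipartiteGraph_adj]
  constructor
  · rintro (⟨rfl, y, rfl⟩ | ⟨rfl, y, rfl⟩)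
    · exact ⟨.inl 0, .inr y, by simp⟩
    · exact ⟨.inr y, .inl 0, by simp⟩
  · rintro ⟨x | x, y | y, h, rfl, rfl⟩
    · simp at h
    · exact .inl ⟨by rw [Subsingleton.elim x 0], y, rfl⟩
    · exact .inr ⟨by rw [Subsingleton.elim y 0], x, rfl⟩
    · simp at h

theorem isStar_iff {t n : ℕ} {F : Finset (Sym2 (Fin n))} :
    IsStar t (F : Set (Sym2 (Fin n))) ↔ ∃ v, F ⊆ incEdges {v} ∧ #F = t := by
  constructor
  · rintro ⟨φ, hF⟩
    rw [edgeSet_map_star, coe_inj] at hF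
    have hd : Disjoint {φ (.inl 0)} (univ.map (Function.Embedding.inr.trans φ)) := by
      simp
    exact ⟨φ (.inl 0), hF ▸ crossEdges_subset_incEdges hd, by simp [hF, card_crossEdges hd]⟩
  · rintro ⟨v, hF, hcard⟩
    let S : Finset (Fin n) := {w | s(v, w) ∈ F}
    have hvS : v ∉ S := by
      intro h
      have := hF (mem_filter.1 h).2
      simp [mk_mem_incEdges] at this
    have hFS : F = crossEdges {v} S := by
      ext e
      induction e with | _ x y =>
      simp only [mk_mem_crossEdges, mem_singleton, S, mem_filter, mem_univ, true_and]
      constructor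
      · intro he
        obtain ⟨-, h | h⟩ := mk_mem_incEdges.1 (hF he)
        · obtain rfl := mem_singleton.1 h
          exact .inl ⟨rfl, he⟩
        · obtain rfl := mem_singleton.1 h
          exact .inr ⟨rfl, Sym2.eq_swap ▸ he⟩
      · rintro (⟨rfl, h⟩ | ⟨rfl, h⟩)
        · exact h
        · exact Sym2.eq_swap ▸ h
    have hS : #S = t := by
      rw [hFS, card_crossEdges (by simpa using hvS)] at hcard
      simpa using hcard
    let ψ : Fin 1 ⊕ Fin t → Fin n := Sum.elim (fun _ => v) (S.orderEmbOfFin hS)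
    have hψ : Function.Injective ψ := by
      refine Function.Injective.sumElim (fun _ _ _ => Subsingleton.elim _ _)
        (S.orderEmbOfFin hS).injective fun _ y h => hvS ?_
      rw [h]
      exact S.orderEmbOfFin_mem hS y
    refine ⟨⟨ψ, hψ⟩, ?_⟩
    rw [edgeSet_map_star, hFS, coe_inj]
    congr 1
    ext x
    have hx : x ∈ S ↔ ∃ a, S.orderEmbOfFin hS a = x := by
      rw [← mem_coe, ← range_orderEmbOfFin S hS, Set.mem_range]
    simpa [ψ] using hx

/-! ### Identification of the two ends of the chain. -/

theorem starSparse_iff_forall_not_isStar {t n : ℕ} (ht : 3 ≤ t) {I : Finset (Sym2 (Fin n))} :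
    StarSparse t t I ↔ (∀ e ∈ I, ¬ e.IsDiag) ∧ #I ≤ t ∧
      ∀ J : Finset (Sym2 (Fin n)), J ⊆ I → ¬ IsStar t (J : Set (Sym2 (Fin n))) := by
  have hτ := starTau_bounds ht
  constructor
  · refine fun h => ⟨h.1, h.2.1, fun J hJ hs => ?_⟩
    obtain ⟨v, hv, hcard⟩ := isStar_iff.1 hs
    have h1 := h.2.2 {v} (by simp; omega)
    have h2 := card_le_card (subset_inter hJ hv)
    rw [card_singleton, starF_one] at h1
    omega
  · refine fun h => ⟨h.1, h.2.1, fun B hB => ?_⟩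
    -- For |B| ≥ 2 the bound f(|B|) ≥ t is implied by |I| ≤ t; only single vertices, with f(1) =
    -- t−1, impose a condition.
    obtain h2 | h2 := le_or_gt 2 #B
    · refine (card_le_card inter_subset_left).trans (h.2.1.trans ?_)
      exact (le_starF_two ht).trans (starF_le_starF h2 (by omega))
    · obtain h0 | h1 : #B = 0 ∨ #B = 1 := by omega
      · rw [card_eq_zero] at h0
        simp [h0, incEdges_empty]
      · obtain ⟨v, rfl⟩ := card_eq_one.1 h1
        by_contra! hlt
        rw [card_singleton, starF_one] at hlt
        obtain ⟨J, hJ, hcard⟩ := exists_subset_card_eq (n := t) (s := I ∩ incEdges {v}) (by omega)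
        exact h.2.2 J (hJ.trans inter_subset_left)
          (isStar_iff.2 ⟨v, hJ.trans inter_subset_right, hcard⟩)

theorem isUniformStarMatroid_iff {t n : ℕ} (ht : 3 ≤ t) (hn : 2 * starTau t ≤ n)
    {M : Matroid (Sym2 (Fin n))} : IsUniformStarMatroid t n M ↔ IsStarSparseMatroid t t M := by
  have hV : 2 * starTau t ≤ Fintype.card (Fin n) := by simpa using hn
  constructor
  · rintro ⟨hE, hr, hC⟩
    rw [completeEdges_eq] at hE
    refine ⟨hE, fun I => ?_⟩
    rw [starSparse_iff_forall_not_isStar ht]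
    constructor
    · refine fun hI => ⟨fun e he => ?_, ?_, fun J hJ hs => ?_⟩
      · have := hI.subset_ground (mem_coe.2 he)
        rwa [hE] at this
      · have := hI.encard_le_eRank
        rwa [hr, Set.encard_coe_eq_coe_finsetCard, Nat.cast_le] at this
      · exact ((hC _).2 hs).1.not_indep (hI.subset (coe_subset.2 hJ))
    · rintro ⟨hd, hcard, hs⟩
      by_contra hI
      have hIE : (I : Set (Sym2 (Fin n))) ⊆ M.E := by
        rw [hE]
        exact hd
      obtain ⟨C, hCI, hCc⟩ := Matroid.Dep.exists_isCircuit_subset ⟨hI, hIE⟩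
      lift C to Finset (Sym2 (Fin n)) using C.toFinite
      by_cases hsp : M.Spanning C
      · have h1 := hCc.eRk_add_one_eq
        rw [hsp.eRk_eq, hr, Set.encard_coe_eq_coe_finsetCard] at h1
        have h2 := card_le_card (coe_subset.1 hCI)
        have h3 : t + 1 = #C := by exact_mod_cast h1
        omega
      · exact hs C (coe_subset.1 hCI) ((hC _).1 ⟨hCc, hsp⟩)
  · intro h
    have hr := h.eRank_eq ht (le_starF_starTau ht) hV
    have hE : M.E = completeEdges n := by rw [h.ground, completeEdges_eq]
    refine ⟨hE, hr, fun C => ?_⟩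
    lift C to Finset (Sym2 (Fin n)) using C.toFinite
    constructor
    · rintro ⟨hC, hsp⟩
      have h1 := hC.eRk_add_one_eq
      rw [Matroid.spanning_iff_eRk_le hC.subset_ground, not_le, hr] at hsp
      have h2 : #C ≤ t := by
        have h3 := Order.add_one_le_of_lt hsp
        rwa [h1, Set.encard_coe_eq_coe_finsetCard, Nat.cast_le] at h3
      have h3 := hC.not_indep
      have hd : ∀ e ∈ C, ¬ e.IsDiag := by
        have := hC.subset_ground
        rw [h.ground] at this
        exact this
      rw [h.indep_iff, starSparse_iff_forall_not_isStar ht] at h3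
      push Not at h3
      obtain ⟨J, hJ, hs⟩ := h3 hd h2
      obtain ⟨v, -, hcard⟩ := isStar_iff.1 hs
      rwa [← eq_of_subset_of_card_le hJ (by omega)]
    · intro hs
      obtain ⟨v, hv, hcard⟩ := isStar_iff.1 hs
      have hCE : (C : Set (Sym2 (Fin n))) ⊆ M.E :=
        (coe_subset.2 hv).trans (h.incEdges_subset_ground _)
      have hd : ∀ e ∈ C, ¬ e.IsDiag := fun e he => (mem_incEdges.1 (hv he)).1
      have hC : M.IsCircuit C := by
        refine Matroid.isCircuit_iff_forall_ssubset.2 ⟨⟨fun hI => ?_, hCE⟩, fun I hI => ?_⟩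
        · rw [h.indep_iff, starSparse_iff_forall_not_isStar ht] at hI
          exact hI.2.2 C le_rfl hs
        · lift I to Finset (Sym2 (Fin n)) using I.toFinite
          have hlt := card_lt_card (coe_ssubset.1 hI)
          rw [h.indep_iff, starSparse_iff_forall_not_isStar ht]
          refine ⟨fun e he => hd e (hI.1 he), by omega, fun J hJ hs' => ?_⟩
          obtain ⟨w, -, hw⟩ := isStar_iff.1 hs'
          have := card_le_card hJ
          omega
      refine ⟨hC, fun hsp => ?_⟩
      have h1 := hC.eRk_add_one_eq
      rw [hsp.eRk_eq, hr, Set.encard_coe_eq_coe_finsetCard, hcard] at h1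
      have h2 : t + 1 = t := by exact_mod_cast h1
      omega

theorem Matroid.IsCircuit.isCyclicFlat_closure {α : Type*} {M : Matroid α} {C : Set α}
    (hC : M.IsCircuit C) : M.IsCyclicFlat (M.closure C) := by
  refine ⟨M.isFlat_closure C, fun e he => ?_⟩
  have hCcl := M.subset_closure C hC.subset_ground
  by_cases heC : e ∈ C
  · exact ⟨C, hC, heC, hCcl⟩
  · obtain ⟨C', hC', hCc, heC'⟩ := exists_isCircuit_of_mem_closure he heC
    exact ⟨C', hCc, heC', hC'.trans (Set.insert_subset he hCcl)⟩

theorem exists_isCliqueJoinIndep_iff {t n : ℕ} (hn : starTau t ≤ n) (hτ : 2 ≤ starTau t)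
    {F : Set (Sym2 (Fin n))} :
    (F = ∅ ∨ F = completeEdges n ∨ ∃ b, 1 ≤ b ∧ b ≤ starTau t - 1 ∧ IsCliqueJoinIndep b F) ↔
      F = completeEdges n ∨ ∃ B : Finset (Fin n), #B < starTau t ∧ F = incEdges B := by
  constructor
  · rintro (rfl | rfl | ⟨b, hb1, hb, hF⟩)
    · exact .inr ⟨∅, by simp; omega, by simp [incEdges_empty]⟩
    · exact .inl rfl
    · obtain ⟨B, rfl, rfl⟩ := (isCliqueJoinIndep_iff (by omega)).1 hF
      exact .inr ⟨B, by omega, rfl⟩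
  · rintro (rfl | ⟨B, hB, rfl⟩)
    · exact .inr (.inl rfl)
    · obtain rfl | hne := B.eq_empty_or_nonempty
      · exact .inl (by simp [incEdges_empty])
      · exact .inr (.inr ⟨#B, card_pos.2 hne, by omega,
          (isCliqueJoinIndep_iff (by omega)).2 ⟨B, rfl, rfl⟩⟩)

/-- The closure of a circuit C is a cyclic flat F, and |C| = r(F)+1. So a set meeting each cyclic
flat F in at most r(F) elements is independent: cyclic flats and their ranks determine the matroid.
-/
theorem isMtn_iff {t n : ℕ} (ht : 3 ≤ t) (hn : 2 * starTau t ≤ n) {M : Matroid (Sym2 (Fin n))} :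
    IsMtn t n M ↔ IsStarSparseMatroid t (starF t (starTau t)) M := by
  have hV : 2 * starTau t ≤ Fintype.card (Fin n) := by simpa using hn
  have hτ := starTau_bounds ht
  constructor
  · rintro ⟨hE, hF, -, hr, hrF⟩
    have hτn : starTau t ≤ n := by omega
    simp_rw [exists_isCliqueJoinIndep_iff hτn hτ.1] at hF
    have hrB : ∀ B : Finset (Fin n), #B < starTau t → M.eRk (incEdges B) = starF t #B := by
      intro B hB
      obtain rfl | hne := B.eq_empty_or_nonempty
      · simp [incEdges_empty, starF_zero]
      · exact hrF _ (card_pos.2 hne) (by omega) _ ((isCliqueJoinIndep_iff (by omega)).2 ⟨B, rfl, rfl⟩)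
    have hE' := hE
    rw [completeEdges_eq] at hE'
    rw [← hE, M.eRk_ground] at hr
    refine ⟨hE', fun I => ⟨fun hI => ⟨fun e he => ?_, ?_, fun B hB => ?_⟩, fun hI => ?_⟩⟩
    · have := hI.subset_ground (mem_coe.2 he)
      rwa [hE'] at this
    · have := hI.encard_le_eRank
      rwa [hr, Set.encard_coe_eq_coe_finsetCard, Nat.cast_le] at this
    · have := (hI.subset (coe_subset.2 inter_subset_left)).encard_le_eRk_of_subset
        (coe_subset.2 (inter_subset_right : I ∩ incEdges B ⊆ incEdges B))
      rwa [hrB B hB, Set.encard_coe_eq_coe_finsetCard, Nat.cast_le] at this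
    · by_contra hdep
      have hIE : (I : Set (Sym2 (Fin n))) ⊆ M.E := by
        rw [hE']
        exact hI.1
      obtain ⟨C, hCI, hC⟩ := Matroid.Dep.exists_isCircuit_subset ⟨hdep, hIE⟩
      lift C to Finset (Sym2 (Fin n)) using C.toFinite
      have hCI' := coe_subset.1 hCI
      have h1 := hC.eRk_add_one_eq
      rw [Set.encard_coe_eq_coe_finsetCard, ← M.eRk_closure_eq] at h1
      have hCcl := M.subset_closure C hC.subset_ground
      obtain h2 | ⟨B, hB, h2⟩ := (hF _).1 hC.isCyclicFlat_closure
      · rw [h2, ← hE, M.eRk_ground, hr] at h1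
        have h3 : starF t (starTau t) + 1 = #C := by exact_mod_cast h1
        have h4 := card_le_card hCI'
        have h5 := hI.2.1
        omega
      · rw [h2] at hCcl
        rw [h2, hrB B hB] at h1
        have h3 : starF t #B + 1 = #C := by exact_mod_cast h1
        have h4 := card_le_card (subset_inter hCI' (coe_subset.1 hCcl))
        have h5 := hI.2.2 B hB
        omega
  · intro h
    have hE : M.E = completeEdges n := by rw [h.ground, completeEdges_eq]
    refine ⟨hE, fun F => ?_, M.eRk_empty, ?_, fun b hb1 hb F hF => ?_⟩
    · rw [exists_isCliqueJoinIndep_iff (by omega) hτ.1, h.isCyclicFlat_iff ht hV, hE]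
    · rw [← hE, M.eRk_ground, h.eRank_eq ht le_rfl hV]
    · obtain ⟨B, rfl, rfl⟩ := (isCliqueJoinIndep_iff (by omega)).1 hF
      exact h.eRk_incEdges ht le_rfl hV (by omega) (starF_le_starF (by omega) hτ.2.1)

theorem theoremA11 (t n : ℕ) (ht : 3 ≤ t) (hn : 2 * starTau t ≤ n) :
    (∃! M₀ : Matroid (Sym2 (Fin n)), IsUniformStarMatroid t n M₀) ∧
    (∃! M : Matroid (Sym2 (Fin n)), IsMtn t n M) ∧
    ∀ M₀ M : Matroid (Sym2 (Fin n)), IsUniformStarMatroid t n M₀ → IsMtn t n M →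
      M₀.IsFreeElevation M ∧
      (∀ M' : Matroid (Sym2 (Fin n)), M₀.IsFreeElevation M' → M' = M) ∧
      M.eRank = (starF t (starTau t) : ℕ∞) ∧
      (∀ F : Set (Sym2 (Fin n)), M.IsCyclicFlat F ↔ F = ∅ ∨ F = completeEdges n ∨
        ∃ b, 1 ≤ b ∧ b ≤ starTau t - 1 ∧ IsCliqueJoinIndep b F) := by
  have hV : 2 * starTau t ≤ Fintype.card (Fin n) := by simpa using hn
  simp_rw [isUniformStarMatroid_iff ht hn]
  refine ⟨?_, ?_, fun M₀ M h₀ hM => ?_⟩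
  · obtain ⟨M₀, h₀⟩ := exists_isStarSparseMatroid (V := Fin n) ht (le_starF_starTau ht)
    exact ⟨M₀, h₀, fun N hN => hN.unique h₀⟩
  · simp_rw [isMtn_iff ht hn]
    obtain ⟨M, h⟩ := exists_isStarSparseMatroid (V := Fin n) ht le_rfl
    exact ⟨M, h, fun N hN => hN.unique h⟩
  · have h := (isMtn_iff ht hn).1 hM
    exact ⟨h₀.isFreeElevation h ht hV,
      fun N hN => (h₀.isStarSparseMatroid_of_isFreeElevation ht hV hN).unique h,
      h.eRank_eq ht le_rfl hV, hM.2.1⟩
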